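/- Normal curvature of sub-spaces of curvature. Let $r=r(x)$, $x=(x^1,\dots,x^N)\in\Omega\subset\mathbb R^N$ open, be a $C^3$ immersion into the Euclidean space $\mathbb R^{N+C}$ (the ambient space, of class $C$), with $e_i=\partial_{x^i}r$, metric $e_{ij}=e_i\cdot e_j$, normal space spanned by vectors $w_P$ ($P=1,\dots,C$) with dual basis $w^P$, second fundamental tensor $t_{ij}^P w_P=(\partial_{x^j}e_i\cdot w^P)\,w_P$, and Riemann–Christoffel tensor $R_{ikjl}$ of the metric $e_{ij}$, where for a metric $g$ $$R_{\alpha\beta\delta\gamma}=\partial_\delta\Gamma_{\beta\gamma,\alpha}-\partial_\gamma\Gamma_{\beta\delta,\alpha}+g^{\lambda\sigma}(\Gamma_{\beta\delta,\lambda}\Gamma_{\alpha\gamma,\sigma}-\Gamma_{\beta\gamma,\lambda}\Gamma_{\alpha\delta,\sigma}),\qquad \Gamma_{\alpha\beta,\gamma}=\tfrac12(\partial_\alpha g_{\beta\gamma}+\partial_\beta g_{\alpha\gamma}-\partial_\gamma g_{\alpha\beta}).$$ Let $x=x(q)$, $q=(q^1,\dots,q^M)\in U$, $U\subset\mathbb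 R^M$ open and connected, be a $C^3$ immersion into $\Omega$ (the sub-space $q^\alpha$). Put $g_\alpha=\partial_{q^\alpha}r(x(q))$, $g_{\alpha\beta}=g_\alpha\cdot g_\beta$, and let $N_{\alpha\beta}=(\partial_{q^\beta}g_\alpha\cdot w^P)\,w_P=\varkappa^P_{\alpha\beta}w_P$ be the vectors of normal curvature. The normal curvature $\kappa_n\ge 0$ is given by $\kappa_n^2=\det(\varkappa^P_{\alpha\beta}\varkappa_{\gamma\delta,P}\,g^{\beta\delta})/\det(g_{\alpha\beta})$. Suppose that for some real function $\hat\kappa$ on $U$ the components of the derivatives $\partial_{q^\delta}N_{\alpha\beta}$ in the tangent space of the ambient space are tangent to the sub-space in the following sense: $$-(\partial_{q^\delta}N_{\alpha\beta}\cdot e_i)\,e^i=\hat\kappa^2 g_{\alpha\beta}\,g_\delta\qquad\text{for all }\alpha,\beta,\delta .$$ Then the sub-space is a sub-space of curvature, i.e. $-(\partial_{q^\delta}N_{\alpha\beta}\,g^{\alpha\delta}\cdot e_i)\,e^i=\hat\kappa^2 g_\beta$; moreover $\varkappa^P_{\alpha\beta}\varkappa_{\gamma\delta,P}=\hat\kappa^2g_{\alpha\beta}g_{\gamma\delta}$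 and $\kappa_n^2=\hat\kappa^{2M}$. If $M\ge2$, put $R_{\alpha\delta\beta\gamma}=R_{ikjl}\,\partial_{q^\alpha}x^i\,\partial_{q^\delta}x^k\,\partial_{q^\beta}x^j\,\partial_{q^\gamma}x^l$ (the components along the sub-space of the curvature tensor of the ambient space) and $R=g^{\alpha\gamma}g^{\beta\delta}R_{\alpha\delta\beta\gamma}$. Then: (a) $R_{\alpha\delta\beta\gamma}=(t_{ij}^Pt_{kl,P}-t_{il}^Pt_{kj,P})\,\partial_{q^\alpha}x^i\,\partial_{q^\beta}x^j\,\partial_{q^\gamma}x^l\,\partial_{q^\delta}x^k$ and $g_{\alpha\beta}g_{\gamma\delta}-g_{\alpha\gamma}g_{\beta\delta}=(e_{ij}e_{kl}-e_{il}e_{kj})\,\partial_{q^\alpha}x^i\,\partial_{q^\beta}x^j\,\partial_{q^\gamma}x^l\,\partial_{q^\delta}x^k$; (b) $R_{\alpha\delta\beta\gamma}=\hat\kappa^2(g_{\alpha\beta}g_{\gamma\delta}-g_{\alpha\gamma}g_{\beta\delta})$ for all indices, so that $$\sqrt[M]{\kappa_n^2}=\hat\kappa^2=\frac{R_{\alpha\delta\beta\gamma}}{g_{\alpha\beta}g_{\gamma\delta}-g_{\alpha\gamma}g_{\beta\delta}}=-\frac{R}{M(M-1)},$$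 the first fraction whenever its denominator is non-zero; (c) the sub-space is isotropic of constant normal curvature: there is a constant $c\ge0$ with $\hat\kappa^2=c^2$ and $\kappa_n=c^M$ on all of $U$, and at every point of $U$ the sectional curvature formed with $R_{\alpha\delta\beta\gamma}$ equals $c^2$ for every plane tangent to the sub-space; (d) if the sub-space is geodesic, i.e. the components of $\partial_{q^\beta}g_\alpha$ that are tangent to the ambient space and orthogonal to the sub-space vanish, then $R_{\alpha\delta\beta\gamma}$ is the Riemann–Christoffel tensor of the metric $g_{\alpha\beta}$ of the sub-space itself. -/

import Mathlib

noncomputable section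

namespace SubspaceCurvature

/-- The partial derivative `∂f/∂xⁱ` at the point `x` of a function of `n` real coordinates. -/
def pd {n : ℕ} {F : Type*} [NormedAddCommGroup F] [NormedSpace ℝ F]
    (f : (Fin n → ℝ) → F) (i : Fin n) (x : Fin n → ℝ) : F :=
  fderiv ℝ f x (Pi.single i 1)

/-! ### Intrinsic geometry of a metric given in coordinates -/

/-- The Christoffel symbols of the first kind
`Γ_{ij,k} = (∂_i g_{jk} + ∂_j g_{ik} - ∂_k g_{ij}) / 2`. -/
def christoffel {n : ℕ} (g : (Fin n → ℝ) → Matrix (Fin n) (Fin n) ℝ)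
    (i j k : Fin n) (x : Fin n → ℝ) : ℝ :=
  (pd (fun y => g y j k) i x + pd (fun y => g y i k) j x - pd (fun y => g y i j) k x) / 2

/-- The covariant Riemann-Christoffel tensor
`R_{abdc} = ∂_d Γ_{bc,a} - ∂_c Γ_{bd,a} + g^{ls} (Γ_{bd,l} Γ_{ac,s} - Γ_{bc,l} Γ_{ad,s})`
(with this sign the unit sphere has `R_{1212} = g_{11} g_{22} - g_{12}²`). -/
def riemann {n : ℕ} (g : (Fin n → ℝ) → Matrix (Fin n) (Fin n) ℝ)
    (a b d c : Fin n) (x : Fin n → ℝ) : ℝ :=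
  pd (christoffel g b c a) d x - pd (christoffel g b d a) c x
    + ∑ l, ∑ s, (g x)⁻¹ l s *
        (christoffel g b d l x * christoffel g a c s x
          - christoffel g b c l x * christoffel g a d s x)

/-! ### Parametrized spaces in a Euclidean space -/

variable {n D : ℕ}

/-- The tangent space at the parameter value `x`: the span of the vectors `∂_i r`. -/
def tangent (r : (Fin n → ℝ) → EuclideanSpace ℝ (Fin D)) (x : Fin n → ℝ) :
    Submodule ℝ (EuclideanSpace ℝ (Fin D)) :=
  Submodule.span ℝ (Set.range fun i => pd r i x)

/-- The fundamental (metric) tensor `∂_i r · ∂_j r`. -/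
def metric (r : (Fin n → ℝ) → EuclideanSpace ℝ (Fin D)) (x : Fin n → ℝ) :
    Matrix (Fin n) (Fin n) ℝ :=
  Matrix.of fun i j => inner ℝ (pd r i x) (pd r j x)

/-- The orthogonal projection of `v` onto the normal space at `x`. For a basis `w_P` of the normal
space with dual basis `w^P` this is the vector `(v · w^P) w_P`, see `normalPart_eq_sum`. -/
def normalPart (r : (Fin n → ℝ) → EuclideanSpace ℝ (Fin D)) (x : Fin n → ℝ)
    (v : EuclideanSpace ℝ (Fin D)) : EuclideanSpace ℝ (Fin D) :=
  (tangent r x)ᗮ.starProjection v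

/-- The orthogonal projection of `v` onto the tangent space at `x`, i.e. `(v · e_i) e^i`. -/
def tangentPart (r : (Fin n → ℝ) → EuclideanSpace ℝ (Fin D)) (x : Fin n → ℝ)
    (v : EuclideanSpace ℝ (Fin D)) : EuclideanSpace ℝ (Fin D) :=
  (tangent r x).starProjection v

theorem normalPart_eq_sum {C : ℕ} (r : (Fin n → ℝ) → EuclideanSpace ℝ (Fin D)) (x : Fin n → ℝ)
    (w w' : Fin C → EuclideanSpace ℝ (Fin D))
    (hw : Submodule.span ℝ (Set.range w) = (tangent r x)ᗮ)
    (hw' : ∀ P, w' P ∈ (tangent r x)ᗮ)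
    (hdual : ∀ P L, inner ℝ (w P) (w' L) = if P = L then (1 : ℝ) else 0)
    (v : EuclideanSpace ℝ (Fin D)) :
    normalPart r x v = ∑ P, inner ℝ v (w' P) • w P := by
  have hmem : normalPart r x v ∈ Submodule.span ℝ (Set.range w) := by
    rw [hw]
    exact Submodule.starProjection_apply_mem _ _
  obtain ⟨c, hc⟩ := (Submodule.mem_span_range_iff_exists_fun ℝ).1 hmem
  rw [← hc]
  refine Finset.sum_congr rfl fun P _ => ?_
  congr 1
  have h1 : inner ℝ (v - normalPart r x v) (w' P) = 0 :=
    Submodule.starProjection_inner_eq_zero v (w' P) (hw' P)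
  rw [inner_sub_left, sub_eq_zero] at h1
  rw [h1, ← hc, sum_inner]
  simp [inner_smul_left, hdual]

/-- The second fundamental tensor `t_{ij} = t_{ij}^P w_P` of the space `r`, as a normal vector:
the normal component of `∂_j e_i`, where `e_i = ∂_i r`. -/
def secondForm (r : (Fin n → ℝ) → EuclideanSpace ℝ (Fin D)) (i j : Fin n) (x : Fin n → ℝ) :
    EuclideanSpace ℝ (Fin D) :=
  normalPart r x (pd (pd r i) j x)

/-! ### A sub-space `x = x(q)` of the space `r = r(x)` -/

variable {N M : ℕ}

/-- The position vector `q ↦ r(x(q))` of the sub-space. -/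
def position (r : (Fin N → ℝ) → EuclideanSpace ℝ (Fin D)) (x : (Fin M → ℝ) → (Fin N → ℝ)) :
    (Fin M → ℝ) → EuclideanSpace ℝ (Fin D) :=
  fun q => r (x q)

/-- The vector of normal curvature `N_{αβ} = (∂_β g_α · w^P) w_P = ϰ_{αβ}^P w_P` of the sub-space:
the component of `∂_β g_α`, where `g_α = ∂_α r(x(q))`, normal to the ambient space. -/
def normalVec (r : (Fin N → ℝ) → EuclideanSpace ℝ (Fin D)) (x : (Fin M → ℝ) → (Fin N → ℝ))
    (α β : Fin M) (q : Fin M → ℝ) : EuclideanSpace ℝ (Fin D) :=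
  normalPart r (x q) (pd (pd (position r x) α) β q)

/-- The vector of geodesic curvature `G_{αβ} = (∂_β g_α · n^Λ) n_Λ` of the sub-space: the component
of `∂_β g_α` tangent to the ambient space and orthogonal to the sub-space. -/
def geodesicVec (r : (Fin N → ℝ) → EuclideanSpace ℝ (Fin D)) (x : (Fin M → ℝ) → (Fin N → ℝ))
    (α β : Fin M) (q : Fin M → ℝ) : EuclideanSpace ℝ (Fin D) :=
  (tangent r (x q) ⊓ (tangent (position r x) q)ᗮ).starProjection
    (pd (pd (position r x) α) β q)

/-- The normal curvature `κ_n`, given by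
`κ_n² = det (ϰ_{αβ}^P ϰ_{γδ,P} g^{βδ}) / det (g_{αβ})`. -/
def normalCurvature (r : (Fin N → ℝ) → EuclideanSpace ℝ (Fin D))
    (x : (Fin M → ℝ) → (Fin N → ℝ)) (q : Fin M → ℝ) : ℝ :=
  √((Matrix.of fun α γ => ∑ β, ∑ δ,
        inner ℝ (normalVec r x α β q) (normalVec r x γ δ q)
          * (metric (position r x) q)⁻¹ β δ).det
      / (metric (position r x) q).det)

/-- The contraction `T_{ikjl} ∂_α xⁱ ∂_δ x^k ∂_β x^j ∂_γ x^l`: the component with indices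
`α, δ, β, γ` along the sub-space of a tensor `T` at the point `x(q)` of the ambient space. -/
def restrict (T : Fin N → Fin N → Fin N → Fin N → ℝ) (x : (Fin M → ℝ) → (Fin N → ℝ))
    (α δ β γ : Fin M) (q : Fin M → ℝ) : ℝ :=
  ∑ i, ∑ k, ∑ j, ∑ l,
    T i k j l * pd x α q i * pd x δ q k * pd x β q j * pd x γ q l

/-- The component `R_{αδβγ} = R_{ikjl} ∂_α xⁱ ∂_δ x^k ∂_β x^j ∂_γ x^l` along the sub-space of the
Riemann-Christoffel tensor of the ambient space. -/
def subRiemann (r : (Fin N → ℝ) → EuclideanSpace ℝ (Fin D)) (x : (Fin M → ℝ) → (Fin N → ℝ))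
    (α δ β γ : Fin M) (q : Fin M → ℝ) : ℝ :=
  restrict (fun i k j l => riemann (metric r) i k j l (x q)) x α δ β γ q

/-- The scalar invariant `R = g^{αγ} g^{βδ} R_{αδβγ}`. -/
def subScalar (r : (Fin N → ℝ) → EuclideanSpace ℝ (Fin D)) (x : (Fin M → ℝ) → (Fin N → ℝ))
    (q : Fin M → ℝ) : ℝ :=
  ∑ α, ∑ β, ∑ γ, ∑ δ, (metric (position r x) q)⁻¹ α γ * (metric (position r x) q)⁻¹ β δ
    * subRiemann r x α δ β γ q

/-- The sectional curvature of the plane spanned by `u` and `v`: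
`R_{αδβγ} u^α v^δ u^β v^γ / ((g_{αβ} g_{γδ} - g_{αγ} g_{βδ}) u^α v^δ u^β v^γ)`. -/
def subSectional (r : (Fin N → ℝ) → EuclideanSpace ℝ (Fin D)) (x : (Fin M → ℝ) → (Fin N → ℝ))
    (u v : Fin M → ℝ) (q : Fin M → ℝ) : ℝ :=
  (∑ α, ∑ δ, ∑ β, ∑ γ, subRiemann r x α δ β γ q * u α * v δ * u β * v γ)
    / (∑ α, ∑ δ, ∑ β, ∑ γ,
        (metric (position r x) q α β * metric (position r x) q γ δ
          - metric (position r x) q α γ * metric (position r x) q β δ)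
          * u α * v δ * u β * v γ)

/-- The sub-space is a sub-space of curvature of the ambient space over the parameter set `U`, with
coefficient `κ`: `-(∂_δ N_{αβ} g^{αδ} · e_i) eⁱ = κ² g_β`. -/
def IsSubspaceOfCurvature (r : (Fin N → ℝ) → EuclideanSpace ℝ (Fin D))
    (x : (Fin M → ℝ) → (Fin N → ℝ)) (U : Set (Fin M → ℝ)) (κ : (Fin M → ℝ) → ℝ) : Prop :=
  ∀ q ∈ U, ∀ β,
    -tangentPart r (x q)
        (∑ α, ∑ δ, (metric (position r x) q)⁻¹ α δ • pd (normalVec r x α β) δ q)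
      = κ q ^ 2 • pd (position r x) β q

end SubspaceCurvature

end

open SubspaceCurvature

/-! Write `g_α` for the coordinate tangent vectors of the sub-space and `N_{αβ}` for the vectors of
normal curvature. Since `N_{αβ}` is normal to the ambient space, `N_{αβ} · g_γ = 0`. Differentiating
this along `δ` trades the prescribed tangential part of `∂_δ N_{αβ}` for `N_{αβ} · N_{γδ}`, which
gives `N_{αβ} · N_{γδ} = κ² g_{αβ} g_{γδ}` (`inner_normalVec_normalVec`). The value of `κ_n` and,
through the Gauss equations (`riemann_metric`) contracted along the sub-space, the formula for
`R_{αδβγ}` are then algebra.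

Constancy of `κ²` is a Schur-type argument (`pd_sq_mul_metric`, `exists_sq_eq`). The product formula
is an equality case of Cauchy-Schwarz, so all the `N_{αβ}` are multiples `g_{αβ} H` of a single
normal vector with `|H|² = κ²`; in particular `κ²` is differentiable although `κ` is an arbitrary
function. Differentiating `H · ∂_β g_α = κ² g_{αβ}` along `γ` and antisymmetrizing in `β, γ` removes
the third derivatives and leaves `∂_γ κ² g_{αβ} = ∂_β κ² g_{αγ}`. With two independent directions
this forces `∂_γ κ² = 0`.

The geodesic case holds because the sub-space's own second fundamental form is the sum of the normal
and geodesic curvature vectors (`secondForm_position`). -/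

namespace SubspaceCurvature

open Filter Topology

/-! ### Partial derivatives: symmetry, product and chain rules. -/

section Calculus

variable {n m : ℕ} {F : Type*} [NormedAddCommGroup F] [NormedSpace ℝ F]

theorem contDiffAt_pd {f : (Fin n → ℝ) → F} {y : Fin n → ℝ} {k l : WithTop ℕ∞}
    (hf : ContDiffAt ℝ l f y) (hkl : k + 1 ≤ l) (i : Fin n) : ContDiffAt ℝ k (pd f i) y :=
  (hf.fderiv_right hkl).clm_apply contDiffAt_const

theorem _root_.Filter.EventuallyEq.pd_eq {f g : (Fin n → ℝ) → F} {y : Fin n → ℝ} (h : f =ᶠ[𝓝 y] g)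
    (i : Fin n) : pd f i y = pd g i y := by
  rw [pd, pd, h.fderiv_eq]

theorem pd_pd {f : (Fin n → ℝ) → F} {y : Fin n → ℝ} (hf : ContDiffAt ℝ 2 f y) (i j : Fin n) :
    pd (pd f i) j y = fderiv ℝ (fderiv ℝ f) y (Pi.single j 1) (Pi.single i 1) := by
  have h : DifferentiableAt ℝ (fderiv ℝ f) y :=
    (hf.fderiv_right (m := 1) (by norm_num)).differentiableAt (by norm_num)
  rw [pd]
  have : pd f i = fun z => fderiv ℝ f z (Pi.single i 1) := rfl
  rw [this, fderiv_clm_apply h (differentiableAt_const _)]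
  simp

theorem pd_comm {f : (Fin n → ℝ) → F} {y : Fin n → ℝ} (hf : ContDiffAt ℝ 2 f y) (i j : Fin n) :
    pd (pd f i) j y = pd (pd f j) i y := by
  rw [pd_pd hf, pd_pd hf]
  exact hf.isSymmSndFDerivAt (by simp) _ _

theorem pd_inner {E : Type*} [NormedAddCommGroup E] [InnerProductSpace ℝ E]
    {f g : (Fin n → ℝ) → E} {y : Fin n → ℝ} (hf : DifferentiableAt ℝ f y)
    (hg : DifferentiableAt ℝ g y) (i : Fin n) :
    pd (fun z => inner ℝ (f z) (g z)) i y = inner ℝ (pd f i y) (g y) + inner ℝ (f y) (pd g i y) := by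
  rw [pd, fderiv_inner_apply ℝ hf hg, add_comm]
  rfl

theorem pd_mul {f g : (Fin n → ℝ) → ℝ} {y : Fin n → ℝ} (hf : DifferentiableAt ℝ f y)
    (hg : DifferentiableAt ℝ g y) (i : Fin n) :
    pd (fun z => f z * g z) i y = pd f i y * g y + f y * pd g i y := by
  rw [pd, fderiv_fun_mul hf hg]
  simp [pd]
  ring

theorem fderiv_eq_zero_of_pd_eq_zero {f : (Fin n → ℝ) → F} {y : Fin n → ℝ}
    (h : ∀ i, pd f i y = 0) : fderiv ℝ f y = 0 := by
  refine ContinuousLinearMap.coe_injective (LinearMap.pi_ext' fun i => ?_)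
  ext
  simpa [pd] using h i

theorem fderiv_apply_eq_sum (f : (Fin n → ℝ) → F) (y v : Fin n → ℝ) :
    fderiv ℝ f y v = ∑ i, v i • pd f i y := by
  conv_lhs => rw [← Finset.univ_sum_single v]
  rw [map_sum]
  refine Finset.sum_congr rfl fun i _ => ?_
  rw [pd, ← map_smul, ← Pi.single_smul']
  simp

theorem pd_comp {f : (Fin n → ℝ) → F} {x : (Fin m → ℝ) → (Fin n → ℝ)} {q : Fin m → ℝ}
    (hf : DifferentiableAt ℝ f (x q)) (hx : DifferentiableAt ℝ x q) (α : Fin m) :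
    pd (fun p => f (x p)) α q = ∑ i, pd x α q i • pd f i (x q) := by
  rw [← fderiv_apply_eq_sum, pd, fderiv_fun_comp q hf hx]
  rfl

end Calculus

/-! ### Tangential and normal projections, and the Gram matrix. -/

section Tangent

variable {n D : ℕ} {r : (Fin n → ℝ) → EuclideanSpace ℝ (Fin D)} {y : Fin n → ℝ}

theorem pd_mem_tangent (r : (Fin n → ℝ) → EuclideanSpace ℝ (Fin D)) (i : Fin n)
    (y : Fin n → ℝ) : pd r i y ∈ tangent r y :=
  Submodule.subset_span ⟨i, rfl⟩

theorem metric_comm (r : (Fin n → ℝ) → EuclideanSpace ℝ (Fin D)) (y : Fin n → ℝ) (i j : Fin n) :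
    metric r y i j = metric r y j i :=
  real_inner_comm (pd r j y) (pd r i y)

theorem posDef_metric (h : LinearIndependent ℝ fun i => pd r i y) : (metric r y).PosDef :=
  Matrix.posDef_gram_of_linearIndependent h

theorem isUnit_det_metric (h : LinearIndependent ℝ fun i => pd r i y) :
    IsUnit (metric r y).det :=
  (posDef_metric h).det_pos.ne'.isUnit

theorem tangentPart_add_normalPart (r : (Fin n → ℝ) → EuclideanSpace ℝ (Fin D)) (y : Fin n → ℝ)
    (v : EuclideanSpace ℝ (Fin D)) : tangentPart r y v + normalPart r y v = v :=
  Submodule.starProjection_add_starProjection_orthogonal v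

theorem tangentPart_mem (r : (Fin n → ℝ) → EuclideanSpace ℝ (Fin D)) (y : Fin n → ℝ)
    (v : EuclideanSpace ℝ (Fin D)) : tangentPart r y v ∈ tangent r y :=
  Submodule.starProjection_apply_mem _ _

theorem normalPart_mem (r : (Fin n → ℝ) → EuclideanSpace ℝ (Fin D)) (y : Fin n → ℝ)
    (v : EuclideanSpace ℝ (Fin D)) : normalPart r y v ∈ (tangent r y)ᗮ :=
  Submodule.starProjection_apply_mem _ _

theorem inner_normalPart_of_mem {u : EuclideanSpace ℝ (Fin D)} (hu : u ∈ (tangent r y)ᗮ)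
    (v : EuclideanSpace ℝ (Fin D)) : inner ℝ u (normalPart r y v) = inner ℝ u v := by
  conv_rhs => rw [← tangentPart_add_normalPart r y v, inner_add_right,
    Submodule.inner_left_of_mem_orthogonal (tangentPart_mem r y v) hu, zero_add]

theorem inner_tangentPart_of_mem {u : EuclideanSpace ℝ (Fin D)} (hu : u ∈ tangent r y)
    (v : EuclideanSpace ℝ (Fin D)) : inner ℝ u (tangentPart r y v) = inner ℝ u v := by
  conv_rhs => rw [← tangentPart_add_normalPart r y v, inner_add_right,
    Submodule.inner_right_of_mem_orthogonal hu (normalPart_mem r y v), add_zero]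

theorem normalPart_add (u v : EuclideanSpace ℝ (Fin D)) :
    normalPart r y (u + v) = normalPart r y u + normalPart r y v :=
  map_add _ _ _

theorem normalPart_smul (a : ℝ) (v : EuclideanSpace ℝ (Fin D)) :
    normalPart r y (a • v) = a • normalPart r y v :=
  map_smul _ _ _

theorem normalPart_sum {ι : Type*} (s : Finset ι) (v : ι → EuclideanSpace ℝ (Fin D)) :
    normalPart r y (∑ i ∈ s, v i) = ∑ i ∈ s, normalPart r y (v i) :=
  map_sum _ _ _

theorem normalPart_pd (r : (Fin n → ℝ) → EuclideanSpace ℝ (Fin D)) (y : Fin n → ℝ) (i : Fin n) :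
    normalPart r y (pd r i y) = 0 := by
  have h := tangentPart_add_normalPart r y (pd r i y)
  rw [tangentPart, Submodule.starProjection_eq_self_iff.2 (pd_mem_tangent r i y)] at h
  simpa using h

/-- The tangential component in terms of the dual basis of the tangent space. -/
theorem tangentPart_eq_sum (h : LinearIndependent ℝ fun i => pd r i y)
    (v : EuclideanSpace ℝ (Fin D)) :
    tangentPart r y v = ∑ l, ∑ s, ((metric r y)⁻¹ l s * inner ℝ v (pd r s y)) • pd r l y := by
  obtain ⟨c, hc⟩ := (Submodule.mem_span_range_iff_exists_fun ℝ).1 (tangentPart_mem r y v)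
  -- Normal equations: pairing the expansion with each tangent vector gives a linear system whose
  -- matrix is the metric.
  have hb : (metric r y).mulVec c = fun s => inner ℝ v (pd r s y) := by
    funext s
    rw [real_inner_comm, ← inner_tangentPart_of_mem (pd_mem_tangent r s y), ← hc, inner_sum]
    simp [Matrix.mulVec, dotProduct, metric, inner_smul_right, mul_comm]
  have hc' : c = (metric r y)⁻¹.mulVec fun s => inner ℝ v (pd r s y) := by
    rw [← hb, Matrix.mulVec_mulVec, Matrix.nonsing_inv_mul _ (isUnit_det_metric h),
      Matrix.one_mulVec]
  rw [← hc]
  refine Finset.sum_congr rfl fun l _ => ?_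
  rw [← Finset.sum_smul]
  congr 1
  conv_lhs => rw [hc']
  rfl

/-- The left side is the inner product of the tangential parts. In the Gauss equations it converts
the quadratic Christoffel terms into products of second derivatives minus products of second
fundamental forms. -/
theorem sum_metric_inv_mul_inner (h : LinearIndependent ℝ fun i => pd r i y)
    (u v : EuclideanSpace ℝ (Fin D)) :
    ∑ l, ∑ s, (metric r y)⁻¹ l s * (inner ℝ u (pd r l y) * inner ℝ v (pd r s y))
      = inner ℝ u v - inner ℝ (normalPart r y u) (normalPart r y v) := by
  have h1 : inner ℝ u v - inner ℝ (normalPart r y u) (normalPart r y v)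
      = inner ℝ u (tangentPart r y v) := by
    rw [real_inner_comm (normalPart r y v), inner_normalPart_of_mem (normalPart_mem r y v),
      real_inner_comm u, sub_eq_iff_eq_add, ← inner_add_right, tangentPart_add_normalPart]
  rw [h1, tangentPart_eq_sum h, inner_sum]
  refine Finset.sum_congr rfl fun l _ => ?_
  rw [inner_sum]
  refine Finset.sum_congr rfl fun s _ => ?_
  rw [inner_smul_right]
  ring

end Tangent

/-! ### Christoffel symbols and curvature of an immersed space. -/

section Gauss

variable {n D : ℕ} {r : (Fin n → ℝ) → EuclideanSpace ℝ (Fin D)} {y : Fin n → ℝ}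

theorem pd_metric (hr : ContDiffAt ℝ 2 r y) (i j k : Fin n) :
    pd (fun z => metric r z i j) k y
      = inner ℝ (pd (pd r i) k y) (pd r j y) + inner ℝ (pd r i y) (pd (pd r j) k y) :=
  pd_inner ((contDiffAt_pd hr (k := 1) (by norm_num) i).differentiableAt (by norm_num))
    ((contDiffAt_pd hr (k := 1) (by norm_num) j).differentiableAt (by norm_num)) k

theorem christoffel_metric (hr : ContDiffAt ℝ 2 r y) (i j k : Fin n) :
    christoffel (metric r) i j k y = inner ℝ (pd (pd r i) j y) (pd r k y) := by
  rw [christoffel, pd_metric hr, pd_metric hr, pd_metric hr, pd_comm hr j i, pd_comm hr k i,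
    pd_comm hr k j, real_inner_comm (pd (pd r i) k y), real_inner_comm (pd (pd r j) k y) (pd r i y)]
  ring

/-- The equations of Gauss. -/
theorem riemann_metric (hr : ContDiffAt ℝ 3 r y) (h : LinearIndependent ℝ fun i => pd r i y)
    (a b d c : Fin n) :
    riemann (metric r) a b d c y
      = inner ℝ (secondForm r a d y) (secondForm r b c y)
        - inner ℝ (secondForm r a c y) (secondForm r b d y) := by
  have hr2 : ContDiffAt ℝ 2 r y := hr.of_le (by norm_num)
  have hpd (i : Fin n) : ContDiffAt ℝ 2 (pd r i) y := contDiffAt_pd hr (by norm_num) i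
  have hpd2 (i j : Fin n) : DifferentiableAt ℝ (pd (pd r i) j) y :=
    (contDiffAt_pd (hpd i) (k := 1) (by norm_num) j).differentiableAt (by norm_num)
  have hG (i j k l : Fin n) : pd (christoffel (metric r) i j k) l y
      = inner ℝ (pd (pd (pd r i) j) l y) (pd r k y)
        + inner ℝ (pd (pd r i) j y) (pd (pd r k) l y) := by
    -- An identity near `y`, not only at `y`, is needed in order to differentiate it.
    have : christoffel (metric r) i j k =ᶠ[𝓝 y] fun z => inner ℝ (pd (pd r i) j z) (pd r k z) :=
      (hr2.eventually (by simp)).mono fun z hz => christoffel_metric hz i j k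
    rw [this.pd_eq, pd_inner (hpd2 i j) ((hpd k).differentiableAt (by norm_num))]
  -- Commuting `c` and `d` makes the two third-derivative terms identical, so they cancel.
  rw [riemann, hG, hG, pd_comm (hpd b) c d]
  simp only [christoffel_metric hr2, mul_sub, Finset.sum_sub_distrib, secondForm]
  rw [sum_metric_inv_mul_inner h, sum_metric_inv_mul_inner h,
    real_inner_comm (normalPart r y (pd (pd r b) d y)),
    real_inner_comm (normalPart r y (pd (pd r b) c y)), real_inner_comm (pd (pd r a) c y),
    real_inner_comm (pd (pd r a) d y)]
  ring

end Gauss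

/-! ### Differentiability of determinants and inverse matrices. -/

section MatrixCalculus

variable {ι E : Type*} [Fintype ι] [DecidableEq ι] [NormedAddCommGroup E] [NormedSpace ℝ E]
  {A : E → Matrix ι ι ℝ} {p : E}

theorem differentiableAt_det (hA : ∀ i j, DifferentiableAt ℝ (fun z => A z i j) p) :
    DifferentiableAt ℝ (fun z => (A z).det) p := by
  simp only [Matrix.det_apply']
  refine DifferentiableAt.fun_sum fun σ _ => DifferentiableAt.const_mul ?_ _
  exact (HasFDerivAt.finsetProd fun i _ => (hA (σ i) i).hasFDerivAt).differentiableAt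

theorem differentiableAt_inv_apply (hA : ∀ i j, DifferentiableAt ℝ (fun z => A z i j) p)
    (h : (A p).det ≠ 0) (i j : ι) : DifferentiableAt ℝ (fun z => (A z)⁻¹ i j) p := by
  simp only [Matrix.inv_def, Matrix.smul_apply, Ring.inverse_eq_inv', smul_eq_mul,
    Matrix.adjugate_apply]
  refine ((differentiableAt_det hA).inv h).mul (differentiableAt_det fun k l => ?_)
  -- Row `j` of the matrix whose determinant gives the adjugate entry is constant; the other rows
  -- are those of `A`.
  by_cases hk : k = j
  · subst hk
    simp
  · simpa [Matrix.updateRow_ne hk] using hA k l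

end MatrixCalculus

/-! ### The sub-space as a composite immersion. -/

section Position

variable {N M D : ℕ} {r : (Fin N → ℝ) → EuclideanSpace ℝ (Fin D)}
  {x : (Fin M → ℝ) → (Fin N → ℝ)} {q : Fin M → ℝ}

theorem contDiffAt_position (hr : ContDiffAt ℝ 3 r (x q)) (hx : ContDiffAt ℝ 3 x q) :
    ContDiffAt ℝ 3 (position r x) q :=
  hr.comp q hx

theorem pd_position (hr : DifferentiableAt ℝ r (x q)) (hx : DifferentiableAt ℝ x q)
    (α : Fin M) : pd (position r x) α q = ∑ i, pd x α q i • pd r i (x q) :=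
  pd_comp hr hx α

theorem pd_position_mem_tangent (hr : DifferentiableAt ℝ r (x q)) (hx : DifferentiableAt ℝ x q)
    (α : Fin M) : pd (position r x) α q ∈ tangent r (x q) := by
  rw [pd_position hr hx]
  exact Submodule.sum_mem _ fun i _ => Submodule.smul_mem _ _ (pd_mem_tangent r i _)

theorem tangent_position_le (hr : DifferentiableAt ℝ r (x q)) (hx : DifferentiableAt ℝ x q) :
    tangent (position r x) q ≤ tangent r (x q) := by
  rw [tangent, Submodule.span_le]
  rintro _ ⟨α, rfl⟩
  exact pd_position_mem_tangent hr hx α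

theorem linearIndependent_pd_position (hr : DifferentiableAt ℝ r (x q))
    (hx : DifferentiableAt ℝ x q) (hri : LinearIndependent ℝ fun i => pd r i (x q))
    (hxi : LinearIndependent ℝ fun α => pd x α q) :
    LinearIndependent ℝ fun α => pd (position r x) α q := by
  rw [Fintype.linearIndependent_iff] at hri hxi ⊢
  intro c hc
  refine hxi c (funext fun i => ?_)
  have := hri (fun i => ∑ α, c α * pd x α q i) ?_ i
  · simpa using this
  rw [← hc]
  simp only [pd_position hr hx, Finset.smul_sum, Finset.sum_smul, smul_smul]
  exact Finset.sum_comm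

theorem pd_pd_position (hr : ContDiffAt ℝ 2 r (x q)) (hx : ContDiffAt ℝ 2 x q) (α β : Fin M) :
    pd (pd (position r x) α) β q
      = ∑ i, (pd x α q i • ∑ j, pd x β q j • pd (pd r i) j (x q)
          + pd (fun p => pd x α p i) β q • pd r i (x q)) := by
  have hev : pd (position r x) α =ᶠ[𝓝 q] fun p => ∑ i, pd x α p i • pd r i (x p) := by
    filter_upwards [hx.eventually (by simp), hx.continuousAt.eventually (hr.eventually (by simp))]
      with p h1 h2
    exact pd_position (h2.differentiableAt (by norm_num)) (h1.differentiableAt (by norm_num)) α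
  have hxd : DifferentiableAt ℝ x q := hx.differentiableAt (by norm_num)
  have hr1 (i : Fin N) : DifferentiableAt ℝ (pd r i) (x q) :=
    (contDiffAt_pd hr (k := 1) (by norm_num) i).differentiableAt (by norm_num)
  have hx1 (i : Fin N) : DifferentiableAt ℝ (fun p => pd x α p i) q :=
    differentiableAt_pi.1
      ((contDiffAt_pd hx (k := 1) (by norm_num) α).differentiableAt (by norm_num)) i
  have hr2 (i : Fin N) : DifferentiableAt ℝ (fun p => pd r i (x p)) q :=
    DifferentiableAt.fun_comp' q (hr1 i) hxd
  rw [hev.pd_eq, pd, fderiv_fun_sum fun i _ => (hx1 i).fun_smul (hr2 i),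
    _root_.sum_apply]
  refine Finset.sum_congr rfl fun i _ => ?_
  rw [fderiv_fun_smul (hx1 i) (hr2 i), ← pd_comp (hr1 i) hxd]
  rfl

/-- The second derivatives of `x` enter `∂_β g_α` only as coefficients of ambient tangent vectors,
so the normal projection kills them and `N_{αβ}` is the pullback of the second fundamental form. -/
theorem normalVec_eq_sum (hr : ContDiffAt ℝ 2 r (x q)) (hx : ContDiffAt ℝ 2 x q) (α β : Fin M) :
    normalVec r x α β q = ∑ i, ∑ j, (pd x α q i * pd x β q j) • secondForm r i j (x q) := by
  rw [normalVec, pd_pd_position hr hx, normalPart_sum]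
  refine Finset.sum_congr rfl fun i _ => ?_
  rw [normalPart_add, normalPart_smul, normalPart_smul, normalPart_pd, smul_zero, add_zero,
    normalPart_sum, Finset.smul_sum]
  refine Finset.sum_congr rfl fun j _ => ?_
  rw [normalPart_smul, smul_smul]
  rfl

theorem metric_position_eq_sum (hr : DifferentiableAt ℝ r (x q)) (hx : DifferentiableAt ℝ x q)
    (α β : Fin M) :
    metric (position r x) q α β
      = ∑ i, ∑ j, (pd x α q i * pd x β q j) • metric r (x q) i j := by
  change inner ℝ (pd (position r x) α q) (pd (position r x) β q) = _
  rw [pd_position hr hx, pd_position hr hx, sum_inner]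
  refine Finset.sum_congr rfl fun i _ => ?_
  rw [inner_sum]
  refine Finset.sum_congr rfl fun j _ => ?_
  rw [inner_smul_left, inner_smul_right, smul_eq_mul, mul_assoc]
  rfl

/-- The projection varies with the point; writing its tangential complement through the inverse Gram
matrix displays it as a differentiable expression. -/
theorem differentiableAt_normalVec (hr : ContDiffAt ℝ 3 r (x q)) (hx : ContDiffAt ℝ 3 x q)
    (hri : ∀ᶠ p in 𝓝 q, LinearIndependent ℝ fun i => pd r i (x p)) (α β : Fin M) :
    DifferentiableAt ℝ (normalVec r x α β) q := by
  have hev : normalVec r x α β =ᶠ[𝓝 q] fun p => pd (pd (position r x) α) β p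
      - ∑ l, ∑ s, ((metric r (x p))⁻¹ l s
        * inner ℝ (pd (pd (position r x) α) β p) (pd r s (x p))) • pd r l (x p) := by
    filter_upwards [hri] with p hp
    rw [← tangentPart_eq_sum hp, normalVec, eq_sub_iff_add_eq']
    exact tangentPart_add_normalPart _ _ _
  refine DifferentiableAt.congr_of_eventuallyEq ?_ hev
  have hv : DifferentiableAt ℝ (pd (pd (position r x) α) β) q :=
    (contDiffAt_pd (contDiffAt_pd (contDiffAt_position hr hx) (k := 2) (by norm_num) α)
      (k := 1) (by norm_num) β).differentiableAt (by norm_num)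
  have he (i : Fin N) : DifferentiableAt ℝ (fun p => pd r i (x p)) q :=
    DifferentiableAt.fun_comp' q
      ((contDiffAt_pd hr (k := 1) (by norm_num) i).differentiableAt (by norm_num))
      (hx.differentiableAt (by norm_num))
  have hg (i j : Fin N) : DifferentiableAt ℝ (fun p => (metric r (x p))⁻¹ i j) q :=
    differentiableAt_inv_apply (fun k l => (he k).inner ℝ (he l))
      (posDef_metric hri.self_of_nhds).det_pos.ne' i j
  refine hv.sub (DifferentiableAt.fun_sum fun l _ => DifferentiableAt.fun_sum fun s _ => ?_)
  exact ((hg l s).mul (hv.inner ℝ (he s))).smul (he l)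

end Position

/-! ### Contraction of ambient tensors along the sub-space. -/

section Restrict

variable {N M : ℕ} {x : (Fin M → ℝ) → (Fin N → ℝ)} {q : Fin M → ℝ}

theorem restrict_sub (S T : Fin N → Fin N → Fin N → Fin N → ℝ) (α δ β γ : Fin M) :
    restrict (fun i k j l => S i k j l - T i k j l) x α δ β γ q
      = restrict S x α δ β γ q - restrict T x α δ β γ q := by
  simp only [restrict, sub_mul, Finset.sum_sub_distrib]

theorem restrict_swap (T : Fin N → Fin N → Fin N → Fin N → ℝ) (α δ β γ : Fin M) :
    restrict (fun i k j l => T i k l j) x α δ β γ q = restrict T x α δ γ β q := by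
  refine Finset.sum_congr rfl fun i _ => Finset.sum_congr rfl fun k _ => ?_
  rw [Finset.sum_comm]
  exact Finset.sum_congr rfl fun l _ => Finset.sum_congr rfl fun j _ => by ring

theorem restrict_inner {E : Type*} [NormedAddCommGroup E] [InnerProductSpace ℝ E]
    (s t : Fin N → Fin N → E) (α δ β γ : Fin M) :
    restrict (fun i k j l => inner ℝ (s i j) (t k l)) x α δ β γ q
      = inner ℝ (∑ i, ∑ j, (pd x α q i * pd x β q j) • s i j)
          (∑ k, ∑ l, (pd x δ q k * pd x γ q l) • t k l) := by
  rw [restrict, sum_inner]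
  refine Finset.sum_congr rfl fun i _ => ?_
  rw [inner_sum]
  refine Finset.sum_congr rfl fun k _ => ?_
  rw [sum_inner]
  refine Finset.sum_congr rfl fun j _ => ?_
  rw [inner_sum]
  refine Finset.sum_congr rfl fun l _ => ?_
  rw [inner_smul_left, inner_smul_right]
  simp only [conj_trivial]
  ring

variable {D : ℕ} {r : (Fin N → ℝ) → EuclideanSpace ℝ (Fin D)}

theorem restrict_metric (hr : DifferentiableAt ℝ r (x q)) (hx : DifferentiableAt ℝ x q)
    (α β γ δ : Fin M) :
    restrict (fun i k j l => metric r (x q) i j * metric r (x q) k l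
        - metric r (x q) i l * metric r (x q) k j) x α δ β γ q
      = metric (position r x) q α β * metric (position r x) q γ δ
        - metric (position r x) q α γ * metric (position r x) q β δ := by
  have h (β γ : Fin M) : restrict (fun i k j l => metric r (x q) i j * metric r (x q) k l)
      x α δ β γ q = metric (position r x) q α β * metric (position r x) q γ δ := by
    rw [metric_comm _ q γ δ, metric_position_eq_sum hr hx, metric_position_eq_sum hr hx]
    -- The entries of the metric are treated as vectors of `ℝ`, whose inner product is
    -- multiplication.
    have := restrict_inner (x := x) (q := q) (metric r (x q)) (metric r (x q)) α δ β γ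
    simp only [RCLike.inner_apply, conj_trivial] at this
    simpa only [mul_comm] using this
  rw [restrict_sub, restrict_swap (fun i k j l => metric r (x q) i j * metric r (x q) k l), h, h]

theorem restrict_secondForm (hr : ContDiffAt ℝ 2 r (x q)) (hx : ContDiffAt ℝ 2 x q)
    (α β γ δ : Fin M) :
    restrict (fun i k j l => inner ℝ (secondForm r i j (x q)) (secondForm r k l (x q))
        - inner ℝ (secondForm r i l (x q)) (secondForm r k j (x q))) x α δ β γ q
      = inner ℝ (normalVec r x α β q) (normalVec r x δ γ q)
        - inner ℝ (normalVec r x α γ q) (normalVec r x δ β q) := by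
  have h (β γ : Fin M) : restrict (fun i k j l =>
      inner ℝ (secondForm r i j (x q)) (secondForm r k l (x q))) x α δ β γ q
      = inner ℝ (normalVec r x α β q) (normalVec r x δ γ q) := by
    rw [restrict_inner (fun i j => secondForm r i j (x q)) (fun i j => secondForm r i j (x q)),
      normalVec_eq_sum hr hx, normalVec_eq_sum hr hx]
  rw [restrict_sub, restrict_swap (fun i k j l =>
    inner ℝ (secondForm r i j (x q)) (secondForm r k l (x q))), h, h]

theorem subRiemann_eq_restrict_secondForm (hr : ContDiffAt ℝ 3 r (x q))
    (hri : LinearIndependent ℝ fun i => pd r i (x q)) (α β γ δ : Fin M) :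
    subRiemann r x α δ β γ q
      = restrict (fun i k j l => inner ℝ (secondForm r i j (x q)) (secondForm r k l (x q))
        - inner ℝ (secondForm r i l (x q)) (secondForm r k j (x q))) x α δ β γ q := by
  simp only [subRiemann, riemann_metric hr hri]

/-- With `S ≤ T` the tangent spaces of the sub-space and of the ambient space, `Sᗮ` is the
orthogonal sum of `Tᗮ` and `T ⊓ Sᗮ`, and the projections onto the summands add up. -/
theorem secondForm_position (hr : DifferentiableAt ℝ r (x q)) (hx : DifferentiableAt ℝ x q)
    (α β : Fin M) :
    secondForm (position r x) α β q = normalVec r x α β q + geodesicVec r x α β q := by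
  set S := tangent (position r x) q
  set T := tangent r (x q)
  have hST : S ≤ T := tangent_position_le hr hx
  set v := pd (pd (position r x) α) β q
  change Sᗮ.starProjection v = _
  refine Submodule.eq_starProjection_of_mem_of_inner_eq_zero ?_ ?_
  · exact Submodule.add_mem _ (Submodule.orthogonal_le hST (normalPart_mem r (x q) v))
      (Submodule.starProjection_apply_mem (T ⊓ Sᗮ) v).2
  · intro w hw
    have hdec := tangentPart_add_normalPart r (x q) v
    have hwT : w = tangentPart r (x q) w + normalPart r (x q) w :=
      (tangentPart_add_normalPart r (x q) w).symm
    have hn : normalPart r (x q) w ∈ Tᗮ := normalPart_mem _ _ _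
    have ht : tangentPart r (x q) w ∈ T ⊓ Sᗮ := by
      refine ⟨tangentPart_mem _ _ _, ?_⟩
      have : tangentPart r (x q) w = w - normalPart r (x q) w := eq_sub_of_add_eq hwT.symm
      rw [this]
      exact Submodule.sub_mem _ hw (Submodule.orthogonal_le hST hn)
    have hG : geodesicVec r x α β q ∈ T ⊓ Sᗮ := Submodule.starProjection_apply_mem _ v
    have h1 : inner ℝ (v - geodesicVec r x α β q) (tangentPart r (x q) w) = 0 :=
      Submodule.starProjection_inner_eq_zero (K := T ⊓ Sᗮ) v _ ht
    have h2 : inner ℝ (v - normalVec r x α β q) (normalPart r (x q) w) = 0 :=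
      Submodule.starProjection_inner_eq_zero (K := Tᗮ) v _ hn
    have h3 : inner ℝ (normalVec r x α β q) (tangentPart r (x q) w) = 0 :=
      Submodule.inner_left_of_mem_orthogonal ht.1 (normalPart_mem r (x q) v)
    have h4 : inner ℝ (geodesicVec r x α β q) (normalPart r (x q) w) = 0 :=
      Submodule.inner_right_of_mem_orthogonal hG.1 hn
    rw [hwT]
    simp only [inner_sub_left, inner_add_left, inner_add_right] at *
    linarith

end Restrict

/-! ### Product formula for the normal curvature vectors and constancy of `κ²`. -/

section Umbilic

variable {N M D : ℕ} {r : (Fin N → ℝ) → EuclideanSpace ℝ (Fin D)}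
  {x : (Fin M → ℝ) → (Fin N → ℝ)} {U : Set (Fin M → ℝ)} {κ : (Fin M → ℝ) → ℝ}

/-- Differentiate `N_{αβ} · g_γ = 0` along `δ`. As `g_γ` is tangent, only the prescribed tangential
part of `∂_δ N_{αβ}` contributes; as `N_{αβ}` is normal, only the normal part of `∂_δ g_γ` does. -/
theorem inner_normalVec_normalVec (hU : IsOpen U) (hr : ∀ q ∈ U, ContDiffAt ℝ 3 r (x q))
    (hri : ∀ q ∈ U, LinearIndependent ℝ fun i => pd r i (x q))
    (hx : ∀ q ∈ U, ContDiffAt ℝ 3 x q)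
    (hκ : ∀ q ∈ U, ∀ α β δ, -tangentPart r (x q) (pd (normalVec r x α β) δ q)
      = (κ q ^ 2 * metric (position r x) q α β) • pd (position r x) δ q)
    {q : Fin M → ℝ} (hq : q ∈ U) (α β γ δ : Fin M) :
    inner ℝ (normalVec r x α β q) (normalVec r x γ δ q)
      = κ q ^ 2 * metric (position r x) q α β * metric (position r x) q γ δ := by
  have hmem {p : Fin M → ℝ} (hp : p ∈ U) : pd (position r x) γ p ∈ tangent r (x p) :=
    pd_position_mem_tangent ((hr p hp).differentiableAt (by norm_num))
      ((hx p hp).differentiableAt (by norm_num)) γ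
  have h0 : (fun p => inner ℝ (normalVec r x α β p) (pd (position r x) γ p)) =ᶠ[𝓝 q]
      fun _ => 0 := by
    filter_upwards [hU.mem_nhds hq] with p hp
    exact Submodule.inner_left_of_mem_orthogonal (hmem hp) (normalPart_mem _ _ _)
  have hN : DifferentiableAt ℝ (normalVec r x α β) q :=
    differentiableAt_normalVec (hr q hq) (hx q hq) (mem_of_superset (hU.mem_nhds hq) hri) α β
  have hP : DifferentiableAt ℝ (pd (position r x) γ) q :=
    (contDiffAt_pd (contDiffAt_position (hr q hq) (hx q hq)) (k := 2) (by norm_num)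
      γ).differentiableAt (by norm_num)
  have h1 := h0.pd_eq δ
  rw [pd_inner hN hP] at h1
  have h2 : inner ℝ (pd (normalVec r x α β) δ q) (pd (position r x) γ q)
      = -(κ q ^ 2 * metric (position r x) q α β * metric (position r x) q γ δ) := by
    rw [real_inner_comm, ← inner_tangentPart_of_mem (hmem hq), ← neg_neg (tangentPart r _ _), hκ q hq,
      inner_neg_right, inner_smul_right]
    rfl
  have h3 : inner ℝ (normalVec r x α β q) (normalVec r x γ δ q)
      = inner ℝ (normalVec r x α β q) (pd (pd (position r x) γ) δ q) :=
    inner_normalPart_of_mem (normalPart_mem _ _ _) _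
  have h4 : pd (fun _ : Fin M → ℝ => (0 : ℝ)) δ q = 0 := by simp [pd]
  linarith

/-- Equality case of Cauchy-Schwarz: by `h` the difference of the two sides has zero norm. -/
theorem normalVec_eq_smul {q : Fin M → ℝ}
    (h : ∀ α β γ δ, inner ℝ (normalVec r x α β q) (normalVec r x γ δ q)
      = κ q ^ 2 * metric (position r x) q α β * metric (position r x) q γ δ)
    {ε : Fin M} (hε : metric (position r x) q ε ε ≠ 0) (α β : Fin M) :
    normalVec r x α β q = metric (position r x) q α β •
      (metric (position r x) q ε ε)⁻¹ • normalVec r x ε ε q := by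
  rw [← sub_eq_zero, ← inner_self_eq_zero (𝕜 := ℝ)]
  simp only [inner_sub_left, inner_sub_right, inner_smul_left, inner_smul_right, h, conj_trivial]
  field_simp
  ring

/-- The square of the coefficient has a differential for which `∂_γ κ² g_{αβ} = ∂_β κ² g_{αγ}`. -/
theorem pd_sq_mul_metric (hU : IsOpen U) (hr : ∀ q ∈ U, ContDiffAt ℝ 3 r (x q))
    (hri : ∀ q ∈ U, LinearIndependent ℝ fun i => pd r i (x q))
    (hx : ∀ q ∈ U, ContDiffAt ℝ 3 x q)
    (hxi : ∀ q ∈ U, LinearIndependent ℝ fun α => pd x α q)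
    (hκ : ∀ q ∈ U, ∀ α β δ, -tangentPart r (x q) (pd (normalVec r x α β) δ q)
      = (κ q ^ 2 * metric (position r x) q α β) • pd (position r x) δ q)
    {q : Fin M → ℝ} (hq : q ∈ U) (ε : Fin M) :
    DifferentiableAt ℝ (fun p => κ p ^ 2) q ∧
    ∀ α β γ, pd (fun p => κ p ^ 2) γ q * metric (position r x) q α β
      = pd (fun p => κ p ^ 2) β q * metric (position r x) q α γ := by
  have hin {p} (hp : p ∈ U) := inner_normalVec_normalVec hU hr hri hx hκ hp
  have hpos {p} (hp : p ∈ U) : 0 < metric (position r x) p ε ε :=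
    (posDef_metric (linearIndependent_pd_position ((hr p hp).differentiableAt (by norm_num))
      ((hx p hp).differentiableAt (by norm_num)) (hri p hp) (hxi p hp))).diag_pos
  have hP := contDiffAt_position (hr q hq) (hx q hq)
  have hP1 (α : Fin M) : DifferentiableAt ℝ (pd (position r x) α) q :=
    (contDiffAt_pd hP (k := 2) (by norm_num) α).differentiableAt (by norm_num)
  have hP2 (α β : Fin M) : DifferentiableAt ℝ (pd (pd (position r x) α) β) q :=
    (contDiffAt_pd (contDiffAt_pd hP (k := 2) (by norm_num) α)
      (k := 1) (by norm_num) β).differentiableAt (by norm_num)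
  have hg (α β : Fin M) : DifferentiableAt ℝ (fun p => metric (position r x) p α β) q :=
    (hP1 α).inner ℝ (hP1 β)
  have hN : DifferentiableAt ℝ (normalVec r x ε ε) q :=
    differentiableAt_normalVec (hr q hq) (hx q hq) (mem_of_superset (hU.mem_nhds hq) hri) ε ε
  -- The common normal vector `H`, with `N_{αβ} = g_{αβ} H`; dividing by `g_{εε} > 0` keeps it
  -- differentiable.
  set H : (Fin M → ℝ) → EuclideanSpace ℝ (Fin D) :=
    fun p => (metric (position r x) p ε ε)⁻¹ • normalVec r x ε ε p with hHdef
  have hH : DifferentiableAt ℝ H q := ((hg ε ε).inv (hpos hq).ne').smul hN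
  have hNH {p} (hp : p ∈ U) (α β : Fin M) :
      normalVec r x α β p = metric (position r x) p α β • H p :=
    normalVec_eq_smul (hin hp) (hpos hp).ne' α β
  have hHmem (p : Fin M → ℝ) : H p ∈ (tangent r (x p))ᗮ :=
    Submodule.smul_mem _ _ (normalPart_mem _ _ _)
  have hHH {p} (hp : p ∈ U) : inner ℝ (H p) (H p) = κ p ^ 2 := by
    have := (hpos hp).ne'
    simp only [hHdef, inner_smul_left, inner_smul_right, hin hp, conj_trivial]
    field_simp
  have hKev : (fun p => κ p ^ 2) =ᶠ[𝓝 q] fun p => inner ℝ (H p) (H p) := by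
    filter_upwards [hU.mem_nhds hq] with p hp using (hHH hp).symm
  have hK : DifferentiableAt ℝ (fun p => κ p ^ 2) q :=
    (hH.inner ℝ hH).congr_of_eventuallyEq hKev
  have hdK (γ : Fin M) : pd (fun p => κ p ^ 2) γ q = 2 * inner ℝ (pd H γ q) (H q) := by
    rw [hKev.pd_eq, pd_inner hH hH, real_inner_comm (pd H γ q)]
    ring
  -- In `∂_γ (g_{εε} H)` the derivative of `g_{εε}` multiplies the normal vector `H`, so it has no
  -- tangential part.
  have hTH (γ : Fin M) : tangentPart r (x q) (pd H γ q) = -(κ q ^ 2 • pd (position r x) γ q) := by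
    have hev : normalVec r x ε ε =ᶠ[𝓝 q] fun p => metric (position r x) p ε ε • H p := by
      filter_upwards [hU.mem_nhds hq] with p hp using hNH hp ε ε
    have h1 : pd (normalVec r x ε ε) γ q = metric (position r x) q ε ε • pd H γ q
        + pd (fun p => metric (position r x) p ε ε) γ q • H q := by
      rw [hev.pd_eq, pd, fderiv_fun_smul (hg ε ε) hH]
      rfl
    have h0 : tangentPart r (x q) (H q) = 0 :=
      (Submodule.starProjection_apply_eq_zero_iff _).2 (hHmem q)
    have h2 := hκ q hq ε ε γ
    rw [h1, tangentPart, map_add, map_smul, map_smul] at h2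
    rw [tangentPart] at h0 ⊢
    rw [h0, smul_zero, add_zero, mul_comm, mul_smul, ← smul_neg] at h2
    rw [← smul_right_injective _ (hpos hq).ne' h2, neg_neg]
  -- Split `∂_β g_α` into tangential and normal parts: the first meets the tangential part of `∂_γ
  -- H`, the second is `g_{αβ} H`.
  have hkey (α β γ : Fin M) : inner ℝ (pd H γ q) (pd (pd (position r x) α) β q)
      = -(κ q ^ 2 * inner ℝ (pd (position r x) γ q) (pd (pd (position r x) α) β q))
        + metric (position r x) q α β * inner ℝ (pd H γ q) (H q) := by
    have h1 : inner ℝ (pd H γ q) (normalVec r x α β q)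
        = metric (position r x) q α β * inner ℝ (pd H γ q) (H q) := by
      rw [hNH hq, inner_smul_right]
    have h2 : inner ℝ (pd H γ q) (tangentPart r (x q) (pd (pd (position r x) α) β q))
        = -(κ q ^ 2 * inner ℝ (pd (position r x) γ q) (pd (pd (position r x) α) β q)) := by
      rw [real_inner_comm, ← inner_tangentPart_of_mem (tangentPart_mem _ _ _), hTH,
        inner_neg_right, inner_smul_right, real_inner_comm, inner_tangentPart_of_mem]
      exact pd_position_mem_tangent ((hr q hq).differentiableAt (by norm_num))
        ((hx q hq).differentiableAt (by norm_num)) γ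
    conv_lhs => rw [← tangentPart_add_normalPart r (x q) (pd (pd (position r x) α) β q)]
    rw [inner_add_right, h2]
    exact congrArg _ h1
  have hdiff (α β γ : Fin M) : inner ℝ (pd H γ q) (pd (pd (position r x) α) β q)
      + inner ℝ (H q) (pd (pd (pd (position r x) α) β) γ q)
      = pd (fun p => κ p ^ 2) γ q * metric (position r x) q α β
        + κ q ^ 2 * (inner ℝ (pd (pd (position r x) α) γ q) (pd (position r x) β q)
          + inner ℝ (pd (position r x) α q) (pd (pd (position r x) β) γ q)) := by
    have hev : (fun p => inner ℝ (H p) (pd (pd (position r x) α) β p)) =ᶠ[𝓝 q]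
        fun p => κ p ^ 2 * metric (position r x) p α β := by
      filter_upwards [hU.mem_nhds hq] with p hp
      rw [← inner_normalPart_of_mem (hHmem p)]
      change inner ℝ (H p) (normalVec r x α β p) = _
      rw [hNH hp, inner_smul_right, hHH hp, mul_comm]
    have := hev.pd_eq γ
    rw [pd_inner hH (hP2 α β), pd_mul hK (hg α β), pd_metric (hP.of_le (by norm_num))] at this
    exact this
  refine ⟨hK, fun α β γ => ?_⟩
  have e1 := hdiff α β γ
  have e2 := hdiff α γ β
  rw [hkey] at e1 e2
  -- After these exchanges the third derivatives agree in `e1` and `e2`. Subtracting cancels them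
  -- and all terms in `κ²` itself, leaving half of the desired relation.
  rw [pd_comm (contDiffAt_pd hP (by norm_num) α) β γ] at e1
  rw [pd_comm (hP.of_le (by norm_num)) γ β] at e2
  rw [real_inner_comm _ (pd (position r x) γ q)] at e1
  rw [real_inner_comm _ (pd (position r x) β q)] at e2
  have k1 := hdK γ
  have k2 := hdK β
  rw [k1] at e1
  rw [k2] at e2
  rw [k1, k2]
  linarith

theorem exists_sq_eq (hM : 2 ≤ M) (hU : IsOpen U) (hU' : IsPreconnected U)
    (hr : ∀ q ∈ U, ContDiffAt ℝ 3 r (x q))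
    (hri : ∀ q ∈ U, LinearIndependent ℝ fun i => pd r i (x q))
    (hx : ∀ q ∈ U, ContDiffAt ℝ 3 x q)
    (hxi : ∀ q ∈ U, LinearIndependent ℝ fun α => pd x α q)
    (hκ : ∀ q ∈ U, ∀ α β δ, -tangentPart r (x q) (pd (normalVec r x α β) δ q)
      = (κ q ^ 2 * metric (position r x) q α β) • pd (position r x) δ q) :
    ∃ c : ℝ, 0 ≤ c ∧ ∀ q ∈ U, κ q ^ 2 = c ^ 2 := by
  have : Nontrivial (Fin M) := Fin.nontrivial_iff_two_le.2 hM
  have hkey {q} (hq : q ∈ U) := pd_sq_mul_metric hU hr hri hx hxi hκ hq ⟨0, by omega⟩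
  obtain ⟨a, ha⟩ := hU.exists_is_const_of_fderiv_eq_zero hU'
    (f := fun p => κ p ^ 2) (fun q hq => (hkey hq).1.differentiableWithinAt) fun q hq => by
      refine fderiv_eq_zero_of_pd_eq_zero fun γ => ?_
      obtain ⟨β, hβ⟩ := exists_ne γ
      have hLI := linearIndependent_pd_position ((hr q hq).differentiableAt (by norm_num))
        ((hx q hq).differentiableAt (by norm_num)) (hri q hq) (hxi q hq)
      -- This vector lies in the span of the `g_α` and is orthogonal to each of them.
      have hz : pd (fun p => κ p ^ 2) γ q • pd (position r x) β q
          + (-pd (fun p => κ p ^ 2) β q) • pd (position r x) γ q = 0 := by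
        have h (α : Fin M) : inner ℝ (pd (position r x) α q)
            (pd (fun p => κ p ^ 2) γ q • pd (position r x) β q
              + (-pd (fun p => κ p ^ 2) β q) • pd (position r x) γ q) = 0 := by
          have := (hkey hq).2 α β γ
          simp only [metric, Matrix.of_apply] at this
          rw [inner_add_right, inner_smul_right, inner_smul_right, this]
          ring
        rw [← inner_self_eq_zero (𝕜 := ℝ)]
        conv_lhs => rw [inner_add_left, inner_smul_left, inner_smul_left, h, h]
        simp
      have := Fintype.linearIndependent_iff.1 hLI
        -- As `β ≠ γ`, the coefficient at `β` is exactly `∂_γ κ²`.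
        (Pi.single β (pd (fun p => κ p ^ 2) γ q) + Pi.single γ (-pd (fun p => κ p ^ 2) β q)) ?_ β
      · simpa [hβ] using this
      · simpa [add_smul, Finset.sum_add_distrib, Pi.single_apply, ite_smul] using hz
  obtain rfl | ⟨q, hq⟩ := U.eq_empty_or_nonempty
  · exact ⟨0, le_rfl, by simp⟩
  · exact ⟨|κ q|, abs_nonneg _, fun p hp => by rw [sq_abs, ha p hp, ← ha q hq]⟩

end Umbilic

/-! ### Contractions of a symmetric matrix with its inverse. -/

section Algebra

variable {n : ℕ} {g : Matrix (Fin n) (Fin n) ℝ}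

theorem sum_inv_mul_inv_mul (hg : IsUnit g.det) (hs : ∀ i j, g i j = g j i) :
    ∑ a, ∑ b, ∑ c, ∑ d, g⁻¹ a c * g⁻¹ b d * (g a b * g c d - g a c * g b d)
      = -((n : ℝ) * ((n : ℝ) - 1)) := by
  have hδ (a b : Fin n) : ∑ c, g⁻¹ a c * g c b = (1 : Matrix (Fin n) (Fin n) ℝ) a b := by
    rw [← Matrix.nonsing_inv_mul g hg, Matrix.mul_apply]
  have h1 : ∑ a, ∑ b, ∑ c, ∑ d, g⁻¹ a c * g⁻¹ b d * (g a b * g c d) = n := by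
    have (a b : Fin n) : ∑ c, ∑ d, g⁻¹ a c * g⁻¹ b d * (g a b * g c d)
        = g⁻¹ b a * g a b := by
      have h (c : Fin n) : ∑ d, g⁻¹ a c * g⁻¹ b d * (g a b * g c d)
          = g⁻¹ a c * g a b * (1 : Matrix (Fin n) (Fin n) ℝ) b c := by
        rw [← hδ, Finset.mul_sum]
        exact Finset.sum_congr rfl fun d _ => by rw [hs c d]; ring
      have hi : g⁻¹ a b = g⁻¹ b a := by
        have : g.transpose = g := Matrix.ext fun i j => hs j i
        rw [← Matrix.transpose_apply g⁻¹ a b, Matrix.transpose_nonsing_inv, this]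
      simp [h, Matrix.one_apply, hi]
    simp only [this]
    rw [Finset.sum_comm]
    simp [hδ]
  have h2 : ∑ a, ∑ b, ∑ c, ∑ d, g⁻¹ a c * g⁻¹ b d * (g a c * g b d) = (n : ℝ) * n := by
    have (a b : Fin n) : ∑ c, ∑ d, g⁻¹ a c * g⁻¹ b d * (g a c * g b d) = 1 := by
      have h (a : Fin n) : ∑ c, g⁻¹ a c * g a c = 1 := by
        simpa [hs _ a] using hδ a a
      have e : (∑ c, g⁻¹ a c * g a c) * ∑ d, g⁻¹ b d * g b d = 1 := by rw [h, h, one_mul]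
      rw [← e, Finset.sum_mul_sum]
      exact Finset.sum_congr rfl fun c _ => Finset.sum_congr rfl fun d _ => by ring
    simp [this]
  simp only [mul_sub (_ * _), Finset.sum_sub_distrib, h1, h2]
  ring

theorem sum_mul_inv_eq (hg : IsUnit g.det) (k : ℝ) (a c : Fin n) :
    ∑ b, ∑ d, k * g a b * g c d * g⁻¹ b d = k * g c a := by
  have h (d : Fin n) : ∑ b, k * g a b * g c d * g⁻¹ b d
      = k * g c d * (1 : Matrix (Fin n) (Fin n) ℝ) a d := by
    rw [← Matrix.mul_nonsing_inv g hg, Matrix.mul_apply, Finset.mul_sum]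
    exact Finset.sum_congr rfl fun b _ => by ring
  rw [Finset.sum_comm]
  simp [h, Matrix.one_apply]

end Algebra

/-! ### Scalar, sectional and normal curvature; the geodesic case. -/

section Invariants

variable {N M D : ℕ} {r : (Fin N → ℝ) → EuclideanSpace ℝ (Fin D)}
  {x : (Fin M → ℝ) → (Fin N → ℝ)} {q : Fin M → ℝ} {k : ℝ}

theorem inner_sum_smul_pd (P : (Fin M → ℝ) → EuclideanSpace ℝ (Fin D)) (u v : Fin M → ℝ) :
    inner ℝ (∑ α, u α • pd P α q) (∑ β, v β • pd P β q)
      = ∑ α, ∑ β, metric P q α β * u α * v β := by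
  rw [sum_inner]
  refine Finset.sum_congr rfl fun α _ => ?_
  rw [inner_sum]
  refine Finset.sum_congr rfl fun β _ => ?_
  rw [inner_smul_left, inner_smul_right, metric, Matrix.of_apply, conj_trivial]
  ring

theorem sum_metric_mul_metric (P : (Fin M → ℝ) → EuclideanSpace ℝ (Fin D)) (u v : Fin M → ℝ) :
    ∑ α, ∑ δ, ∑ β, ∑ γ, (metric P q α β * metric P q γ δ - metric P q α γ * metric P q β δ)
        * u α * v δ * u β * v γ
      = inner ℝ (∑ α, u α • pd P α q) (∑ α, u α • pd P α q)
          * inner ℝ (∑ α, v α • pd P α q) (∑ α, v α • pd P α q)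
        - inner ℝ (∑ α, u α • pd P α q) (∑ α, v α • pd P α q)
          * inner ℝ (∑ α, u α • pd P α q) (∑ α, v α • pd P α q) := by
  simp only [inner_sum_smul_pd, Finset.sum_mul_sum, sub_mul, Finset.sum_sub_distrib]
  refine congrArg₂ (· - ·) ?_ ?_
  · refine Finset.sum_congr rfl fun α _ => Finset.sum_congr rfl fun δ _ =>
      Finset.sum_congr rfl fun β _ => Finset.sum_congr rfl fun γ _ => ?_
    rw [metric_comm P q γ δ]
    ring
  · refine Finset.sum_congr rfl fun α _ => ?_
    rw [Finset.sum_comm]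
    refine Finset.sum_congr rfl fun β _ => ?_
    rw [Finset.sum_comm]
    exact Finset.sum_congr rfl fun γ _ => Finset.sum_congr rfl fun δ _ => by ring

/-- The sum is the Gram determinant of the two independent tangent vectors with components `u` and
`v`. -/
theorem sum_metric_mul_metric_pos {P : (Fin M → ℝ) → EuclideanSpace ℝ (Fin D)}
    (hP : LinearIndependent ℝ fun α => pd P α q) {u v : Fin M → ℝ}
    (huv : LinearIndependent ℝ ![u, v]) :
    0 < ∑ α, ∑ δ, ∑ β, ∑ γ,
      (metric P q α β * metric P q γ δ - metric P q α γ * metric P q β δ)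
        * u α * v δ * u β * v γ := by
  rw [sum_metric_mul_metric]
  have hli : LinearIndependent ℝ ![∑ α, u α • pd P α q, ∑ α, v α • pd P α q] := by
    rw [LinearIndependent.pair_iff] at huv ⊢
    intro s t hst
    refine huv s t (funext fun α => ?_)
    refine Fintype.linearIndependent_iff.1 hP (fun α => s * u α + t * v α) ?_ α
    simpa [add_smul, Finset.sum_add_distrib, Finset.smul_sum, smul_smul] using hst
  have hdet := (Matrix.posDef_gram_of_linearIndependent (𝕜 := ℝ) hli).det_pos
  rw [Matrix.det_fin_two] at hdet
  simp only [Matrix.gram_apply, Matrix.cons_val_zero, Matrix.cons_val_one] at hdet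
  rwa [real_inner_comm (∑ α, u α • pd P α q) (∑ α, v α • pd P α q)] at hdet

theorem subSectional_eq (hP : LinearIndependent ℝ fun α => pd (position r x) α q)
    (hR : ∀ α β γ δ, subRiemann r x α δ β γ q
      = k * (metric (position r x) q α β * metric (position r x) q γ δ
        - metric (position r x) q α γ * metric (position r x) q β δ))
    {u v : Fin M → ℝ} (huv : LinearIndependent ℝ ![u, v]) : subSectional r x u v q = k := by
  rw [subSectional, div_eq_iff (sum_metric_mul_metric_pos hP huv).ne']
  simp only [Finset.mul_sum, hR, mul_assoc]

theorem subScalar_eq (hP : LinearIndependent ℝ fun α => pd (position r x) α q)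
    (hR : ∀ α β γ δ, subRiemann r x α δ β γ q
      = k * (metric (position r x) q α β * metric (position r x) q γ δ
        - metric (position r x) q α γ * metric (position r x) q β δ)) :
    subScalar r x q = -(k * ((M : ℝ) * ((M : ℝ) - 1))) := by
  rw [← mul_neg, ← sum_inv_mul_inv_mul (isUnit_det_metric hP) (metric_comm _ q), subScalar]
  simp only [Finset.mul_sum, hR]
  exact Finset.sum_congr rfl fun α _ => Finset.sum_congr rfl fun δ _ =>
    Finset.sum_congr rfl fun β _ => Finset.sum_congr rfl fun γ _ => by ring

theorem normalCurvature_sq (hP : LinearIndependent ℝ fun α => pd (position r x) α q)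
    (h : ∀ α β γ δ, inner ℝ (normalVec r x α β q) (normalVec r x γ δ q)
      = k ^ 2 * metric (position r x) q α β * metric (position r x) q γ δ) :
    normalCurvature r x q ^ 2 = k ^ (2 * M) := by
  -- The matrix is `k²` times the metric, so the quotient of determinants is `(k²)^M`.
  have hm : (Matrix.of fun α γ => ∑ β, ∑ δ,
      inner ℝ (normalVec r x α β q) (normalVec r x γ δ q)
        * (metric (position r x) q)⁻¹ β δ) = k ^ 2 • metric (position r x) q := by
    ext α γ
    simp only [h, Matrix.of_apply, Matrix.smul_apply, smul_eq_mul]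
    rw [sum_mul_inv_eq (isUnit_det_metric hP), metric_comm]
  rw [normalCurvature, hm, Matrix.det_smul, Fintype.card_fin,
    mul_div_cancel_right₀ _ (posDef_metric hP).det_pos.ne', Real.sq_sqrt (by positivity), pow_mul]

theorem isSubspaceOfCurvature_of_tangentPart {U : Set (Fin M → ℝ)} {κ : (Fin M → ℝ) → ℝ}
    (hP : ∀ q ∈ U, LinearIndependent ℝ fun α => pd (position r x) α q)
    (hκ : ∀ q ∈ U, ∀ α β δ, -tangentPart r (x q) (pd (normalVec r x α β) δ q)
      = (κ q ^ 2 * metric (position r x) q α β) • pd (position r x) δ q) :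
    IsSubspaceOfCurvature r x U κ := by
  intro q hq β
  have h1 : -tangentPart r (x q)
      (∑ α, ∑ δ, (metric (position r x) q)⁻¹ α δ • pd (normalVec r x α β) δ q)
      = ∑ α, ∑ δ, (metric (position r x) q)⁻¹ α δ •
        -tangentPart r (x q) (pd (normalVec r x α β) δ q) := by
    simp only [tangentPart, map_sum, map_smul, smul_neg, Finset.sum_neg_distrib]
  have h2 (δ : Fin M) : ∑ α, (metric (position r x) q)⁻¹ α δ *
      (κ q ^ 2 * metric (position r x) q α β)
      = κ q ^ 2 * (1 : Matrix (Fin M) (Fin M) ℝ) β δ := by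
    rw [← Matrix.mul_nonsing_inv _ (isUnit_det_metric (hP q hq)), Matrix.mul_apply, Finset.mul_sum]
    exact Finset.sum_congr rfl fun α _ => by rw [metric_comm _ q α β]; ring
  rw [h1, Finset.sum_comm]
  simp only [hκ q hq, smul_smul, ← Finset.sum_smul, h2]
  simp [Matrix.one_apply, ite_smul]

theorem riemann_metric_position (hr : ContDiffAt ℝ 3 r (x q)) (hx : ContDiffAt ℝ 3 x q)
    (hri : LinearIndependent ℝ fun i => pd r i (x q))
    (hxi : LinearIndependent ℝ fun α => pd x α q)
    (hG : ∀ α β, geodesicVec r x α β q = 0) (α β γ δ : Fin M) :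
    riemann (metric (position r x)) α δ β γ q = subRiemann r x α δ β γ q := by
  have hr' : DifferentiableAt ℝ r (x q) := hr.differentiableAt (by norm_num)
  have hx' : DifferentiableAt ℝ x q := hx.differentiableAt (by norm_num)
  rw [riemann_metric (contDiffAt_position hr hx)
      (linearIndependent_pd_position hr' hx' hri hxi),
    subRiemann_eq_restrict_secondForm hr hri,
    restrict_secondForm (hr.of_le (by norm_num)) (hx.of_le (by norm_num))]
  simp only [secondForm_position hr' hx', hG, add_zero]

end Invariants

end SubspaceCurvature

/-! ### Sub-spaces of curvature: the combined result. -/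

theorem mainTheorem3 {N M C : ℕ}
    -- the ambient space `r = r(x)`, of dimension `N` and class `C`
    (Ω : Set (Fin N → ℝ)) (hΩ : IsOpen Ω)
    (r : (Fin N → ℝ) → EuclideanSpace ℝ (Fin (N + C)))
    (hr : ContDiffOn ℝ 3 r Ω)
    (hr_imm : ∀ y ∈ Ω, LinearIndependent ℝ fun i => pd r i y)
    -- the sub-space `x = x(q)`, of dimension `M`
    (U : Set (Fin M → ℝ)) (hU : IsOpen U) (hU_conn : IsPreconnected U)
    (x : (Fin M → ℝ) → (Fin N → ℝ))
    (hx : ContDiffOn ℝ 3 x U) (hx_maps : Set.MapsTo x U Ω)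
    (hx_imm : ∀ q ∈ U, LinearIndependent ℝ fun α => pd x α q)
    -- `-(∂_δ N_{αβ} · e_i) eⁱ = κ² g_{αβ} g_δ`
    (κ : (Fin M → ℝ) → ℝ)
    (hκ : ∀ q ∈ U, ∀ α β δ,
      -tangentPart r (x q)
          (pd (normalVec r x α β) δ q)
        = (κ q ^ 2 * metric (position r x) q α β)
            • pd (position r x) δ q) :
    IsSubspaceOfCurvature r x U κ ∧
    -- `ϰ_{αβ}^P ϰ_{γδ,P} = κ² g_{αβ} g_{γδ}`
    (∀ q ∈ U, ∀ α β γ δ,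
      inner ℝ (normalVec r x α β q) (normalVec r x γ δ q)
        = κ q ^ 2 * metric (position r x) q α β
            * metric (position r x) q γ δ) ∧
    (∀ q ∈ U, normalCurvature r x q ^ 2 = κ q ^ (2 * M)) ∧
    (2 ≤ M →
      (∀ q ∈ U, (normalCurvature r x q ^ 2) ^ ((1 : ℝ) / M) = κ q ^ 2) ∧
      -- the denominators: `(e_{ij} e_{kl} - e_{il} e_{kj}) ∂_α xⁱ ∂_β x^j ∂_γ x^l ∂_δ x^k`
      (∀ q ∈ U, ∀ α β γ δ,
        restrict (fun i k j l =>
            metric r (x q) i j * metric r (x q) k l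
              - metric r (x q) i l * metric r (x q) k j)
            x α δ β γ q
          = metric (position r x) q α β
              * metric (position r x) q γ δ
            - metric (position r x) q α γ
              * metric (position r x) q β δ) ∧
      -- the numerators: `(t_{ij}^P t_{kl,P} - t_{il}^P t_{kj,P}) ∂_α xⁱ ∂_β x^j ∂_γ x^l ∂_δ x^k`
      (∀ q ∈ U, ∀ α β γ δ,
        restrict (fun i k j l =>
            inner ℝ (secondForm r i j (x q))
                (secondForm r k l (x q))
              - inner ℝ (secondForm r i l (x q))
                (secondForm r k j (x q)))
            x α δ β γ q
          = subRiemann r x α δ β γ q) ∧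
      (∀ q ∈ U, ∀ α β γ δ,
        subRiemann r x α δ β γ q
          = κ q ^ 2 * (metric (position r x) q α β
              * metric (position r x) q γ δ
            - metric (position r x) q α γ
              * metric (position r x) q β δ)) ∧
      (∀ q ∈ U, ∀ α β γ δ,
        metric (position r x) q α β
              * metric (position r x) q γ δ
            - metric (position r x) q α γ
              * metric (position r x) q β δ ≠ 0 →
        κ q ^ 2 = subRiemann r x α δ β γ q
          / (metric (position r x) q α β
              * metric (position r x) q γ δ
            - metric (position r x) q α γ
              * metric (position r x) q β δ)) ∧
      (∀ q ∈ U, κ q ^ 2 = -(subScalar r x q / ((M : ℝ) * ((M : ℝ) - 1)))) ∧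
      -- the sub-space is isotropic, of constant normal curvature
      (∃ c : ℝ, 0 ≤ c ∧ ∀ q ∈ U,
        κ q ^ 2 = c ^ 2 ∧
        normalCurvature r x q = c ^ M ∧
        ∀ u v : Fin M → ℝ, LinearIndependent ℝ ![u, v] →
          subSectional r x u v q = c ^ 2) ∧
      -- on a geodesic sub-space `R_{αδβγ}` is the sub-space's own Riemann-Christoffel tensor
      ((∀ q ∈ U, ∀ α β, geodesicVec r x α β q = 0) →
        ∀ q ∈ U, ∀ α β γ δ,
          riemann
              (metric (position r x)) α δ β γ q
            = subRiemann r x α δ β γ q)) := by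
  have hr' (q) (hq : q ∈ U) : ContDiffAt ℝ 3 r (x q) :=
    hr.contDiffAt (hΩ.mem_nhds (hx_maps hq))
  have hx' (q) (hq : q ∈ U) : ContDiffAt ℝ 3 x q := hx.contDiffAt (hU.mem_nhds hq)
  have hri (q) (hq : q ∈ U) := hr_imm (x q) (hx_maps hq)
  have hrd (q) (hq : q ∈ U) : DifferentiableAt ℝ r (x q) :=
    (hr' q hq).differentiableAt (by norm_num)
  have hxd (q) (hq : q ∈ U) : DifferentiableAt ℝ x q := (hx' q hq).differentiableAt (by norm_num)
  have hP (q) (hq : q ∈ U) : LinearIndependent ℝ fun α => pd (position r x) α q :=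
    linearIndependent_pd_position (hrd q hq) (hxd q hq) (hri q hq) (hx_imm q hq)
  have hN (q) (hq : q ∈ U) := inner_normalVec_normalVec hU hr' hri hx' hκ hq
  have hn (q) (hq : q ∈ U) := normalCurvature_sq (hP q hq) (hN q hq)
  refine ⟨isSubspaceOfCurvature_of_tangentPart hP hκ, hN, hn, fun hM => ?_⟩
  have hsub (q) (hq : q ∈ U) (α β γ δ : Fin M) :=
    subRiemann_eq_restrict_secondForm (x := x) (hr' q hq) (hri q hq) α β γ δ
  have hR (q) (hq : q ∈ U) (α β γ δ : Fin M) : subRiemann r x α δ β γ q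
      = κ q ^ 2 * (metric (position r x) q α β * metric (position r x) q γ δ
        - metric (position r x) q α γ * metric (position r x) q β δ) := by
    rw [hsub q hq, restrict_secondForm ((hr' q hq).of_le (by norm_num))
      ((hx' q hq).of_le (by norm_num)), hN q hq, hN q hq, metric_comm _ q δ γ, metric_comm _ q δ β]
    ring
  refine ⟨fun q hq => ?_, fun q hq α β γ δ => restrict_metric (hrd q hq) (hxd q hq) α β γ δ,
    fun q hq α β γ δ => (hsub q hq α β γ δ).symm, hR,
    fun q hq α β γ δ h => by rw [hR q hq, mul_div_cancel_right₀ _ h], fun q hq => ?_, ?_,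
    fun hG q hq α β γ δ => riemann_metric_position (hr' q hq) (hx' q hq) (hri q hq)
      (hx_imm q hq) (hG q hq) α β γ δ⟩
  · rw [hn q hq, pow_mul, one_div]
    exact Real.pow_rpow_inv_natCast (sq_nonneg _) (by omega)
  · have h2 : (2 : ℝ) ≤ M := by exact_mod_cast hM
    have h0 : (M : ℝ) * ((M : ℝ) - 1) ≠ 0 := (mul_pos (by linarith) (by linarith)).ne'
    rw [subScalar_eq (hP q hq) (hR q hq), neg_div, neg_neg, mul_div_cancel_right₀ _ h0]
  · obtain ⟨c, hc, h⟩ := exists_sq_eq hM hU hU_conn hr' hri hx' hx_imm hκ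
    refine ⟨c, hc, fun q hq => ⟨h q hq, ?_, fun u v huv => ?_⟩⟩
    -- Both `κ_n` and `c^M` are nonnegative, so comparing squares suffices.
    · refine (sq_eq_sq₀ (Real.sqrt_nonneg _) (pow_nonneg hc M)).1 ?_
      rw [← normalCurvature, hn q hq, pow_mul, h q hq, ← pow_mul, ← pow_mul, mul_comm]
    · rw [subSectional_eq (hP q hq) (hR q hq) huv, h q hq]
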